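/- All graphs are finite and simple. For a graph $G$ with at least one vertex, a weight assignment is a function $w:V(G)\to[0,\infty)$ that is not identically $0$; let $w(Y)=\sum_{y\in Y}w(y)$ for $Y\subseteq V(G)$, and let $\alpha_w(G)$ be the maximum of $w(Y)$ over all independent sets $Y$ of $G$. The fractional chromatic number $\chi_f(G)$ is the supremum of $w(V(G))/\alpha_w(G)$ over all weight assignments $w$. The Hall ratio $\rho(G)$ is the maximum of $|V(H)|/\alpha(H)$ over all non-empty subgraphs $H$ of $G$, where $\alpha(H)$ is the maximum size of an independent set of $H$. For every positive integer $c$, there exists a graph $G$ with $\chi_f(G)\ge c$ and $\rho(G)\le 18$. Moreover, the fractional chromatic number is not bounded by any function of the Hall ratio: there is no function $f:\mathbb{R}\to\mathbb{R}$ such that $\chi_f(G)\le f(\rho(G))$ for every non-empty graph $G$. -/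

import Mathlib

namespace SimpleGraph

/-- A weight assignment for a graph with vertex set `V`: a nonnegative real function on the
vertices that is not identically zero. -/
def IsWeightAssignment {V : Type*} (w : V → ℝ) : Prop :=
  (∀ v, 0 ≤ w v) ∧ ∃ v, w v ≠ 0

/-- `α_w(G)`: the maximum weight `∑ y ∈ Y, w y` of an independent set `Y` of a finite graph. -/
noncomputable def weightedIndepNum {V : Type*} (G : SimpleGraph V) (w : V → ℝ) : ℝ :=
  sSup {r : ℝ | ∃ Y : Finset V, G.IsIndepSet (Y : Set V) ∧ r = ∑ y ∈ Y, w y}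

/-- The fractional chromatic number: the supremum of `w(V(G)) / α_w(G)` over all weight
assignments `w`. -/
noncomputable def fractionalChromaticNumber {V : Type*} [Fintype V] (G : SimpleGraph V) : ℝ :=
  sSup {r : ℝ | ∃ w : V → ℝ, IsWeightAssignment w ∧ r = (∑ v, w v) / G.weightedIndepNum w}

/-- The Hall ratio: the maximum of `|V(H)| / α(H)` over all (nonempty, not necessarily induced)
subgraphs `H` of a finite graph. -/
noncomputable def hallRatio {V : Type*} (G : SimpleGraph V) : ℝ :=
  sSup {r : ℝ | ∃ H : G.Subgraph, H.verts.Nonempty ∧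
    r = (H.verts.ncard : ℝ) / (H.coe.indepNum : ℝ)}

/-- The supremum defining `α_w(G)` is a maximum. -/
theorem isGreatest_weightedIndepNum {V : Type*} [Finite V] (G : SimpleGraph V) (w : V → ℝ) :
    IsGreatest {r : ℝ | ∃ Y : Finset V, G.IsIndepSet (Y : Set V) ∧ r = ∑ y ∈ Y, w y}
      (G.weightedIndepNum w) := by
  have hfin : {r : ℝ | ∃ Y : Finset V, G.IsIndepSet (Y : Set V) ∧ r = ∑ y ∈ Y, w y}.Finite := by
    refine (Set.finite_range fun Y : Finset V => ∑ y ∈ Y, w y).subset ?_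
    rintro r ⟨Y, -, rfl⟩
    exact ⟨Y, rfl⟩
  exact ⟨Set.Nonempty.csSup_mem ⟨0, ∅, by simp, by simp⟩ hfin,
    fun r hr => le_csSup hfin.bddAbove hr⟩

theorem le_weightedIndepNum {V : Type*} [Finite V] (G : SimpleGraph V) (w : V → ℝ) (v : V) :
    w v ≤ G.weightedIndepNum w :=
  (G.isGreatest_weightedIndepNum w).2 ⟨{v}, by simp, by simp⟩

/-- The maximum weight of an independent set is positive, so the ratio is never a division
by zero. -/
theorem weightedIndepNum_pos {V : Type*} [Finite V] (G : SimpleGraph V) {w : V → ℝ}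
    (hw : IsWeightAssignment w) : 0 < G.weightedIndepNum w := by
  obtain ⟨h0, v, hv⟩ := hw
  exact lt_of_lt_of_le (lt_of_le_of_ne (h0 v) (Ne.symm hv)) (G.le_weightedIndepNum w v)

/-- The fractional chromatic number of a nonempty finite graph is a genuine supremum. -/
theorem isLUB_fractionalChromaticNumber {V : Type*} [Fintype V] [Nonempty V]
    (G : SimpleGraph V) :
    IsLUB {r : ℝ | ∃ w : V → ℝ, IsWeightAssignment w ∧
      r = (∑ v, w v) / G.weightedIndepNum w} G.fractionalChromaticNumber := by
  refine isLUB_csSup ⟨_, fun _ => 1, ⟨by simp, by simp⟩, rfl⟩ ⟨(Fintype.card V : ℝ), ?_⟩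
  rintro r ⟨w, hw, rfl⟩
  rw [div_le_iff₀ (G.weightedIndepNum_pos hw)]
  calc ∑ v, w v ≤ ∑ _v : V, G.weightedIndepNum w :=
        Finset.sum_le_sum fun v _ => G.le_weightedIndepNum w v
    _ = _ := by simp

/-- The Hall ratio of a nonempty finite graph is a genuine maximum. -/
theorem isGreatest_hallRatio {V : Type*} [Finite V] [Nonempty V] (G : SimpleGraph V) :
    IsGreatest {r : ℝ | ∃ H : G.Subgraph, H.verts.Nonempty ∧
      r = (H.verts.ncard : ℝ) / (H.coe.indepNum : ℝ)} G.hallRatio := by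
  have hfin : {r : ℝ | ∃ H : G.Subgraph, H.verts.Nonempty ∧
      r = (H.verts.ncard : ℝ) / (H.coe.indepNum : ℝ)}.Finite := by
    refine (Set.finite_range fun H : G.Subgraph =>
      (H.verts.ncard : ℝ) / (H.coe.indepNum : ℝ)).subset ?_
    rintro r ⟨H, -, rfl⟩
    exact ⟨H, rfl⟩
  exact ⟨Set.Nonempty.csSup_mem ⟨_, ⊤, by simp, rfl⟩ hfin,
    fun r hr => le_csSup hfin.bddAbove hr⟩

end SimpleGraph

/-!
Take `k` layers of rapidly decreasing sizes, spread weight `1 / k` evenly over each layer, sample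
`n` pairs of vertices independently from the square of this distribution, and join the sampled
pairs whose ends lie in different layers. With positive probability two things happen.

* Any two sets of weight at least `1 / k ^ 2` are joined by a sampled pair. An independent set then
  has weight at least `1 / k ^ 2` in at most one layer, so its weight is at most
  `1 / k + k / k ^ 2 = 2 / k`; hence `k / 2 ≤ χ_f`.
* Every nonempty set `S` that is light, in the sense that `32 n ^ 3 w(S) ^ 4 ≤ |S| ^ 3`, contains
  fewer than `2 |S|` sampled pairs. Given a set `A`, all subsets of its vertices of small weight
  (compared with `|A|`) are light, so these vertices induce a `3`-degenerate graph. Among the other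
  vertices of `A`, all but `|A| / 2` lie in a single layer, because the layers shrink so fast, and a
  layer is independent. One of the two parts yields an independent set of size `|A| / 10`.

So `χ_f` is unbounded on graphs with `ρ ≤ 10`. A disjoint complete graph on `r` vertices makes
`ρ = r` exactly, which rules out a bound `χ_f ≤ f ρ` even when `f` is not monotone.
-/

open Finset MeasureTheory SimpleGraph

namespace HallRatio

section Monotonicity

variable {V W : Type*} {G : SimpleGraph V} {H : SimpleGraph W}

theorem isIndepSet_preimage (f : G →g H) {Y : Set W} (hY : H.IsIndepSet Y) :
    G.IsIndepSet (f ⁻¹' Y) :=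
  fun _ hu _ hv _ hadj => hY hu hv (f.map_adj hadj).ne (f.map_adj hadj)

theorem sum_div_le_fractionalChromaticNumber [Fintype V] {w : V → ℝ} (hw : IsWeightAssignment w)
    {b : ℝ} (hb : ∀ Y : Finset V, G.IsIndepSet Y → ∑ y ∈ Y, w y ≤ b) :
    (∑ v, w v) / b ≤ G.fractionalChromaticNumber := by
  obtain ⟨v, -⟩ := hw.2
  have : Nonempty V := ⟨v⟩
  refine le_trans ?_ (G.isLUB_fractionalChromaticNumber.1 ⟨w, hw, rfl⟩)
  obtain ⟨Y, hY, hYw⟩ := (G.isGreatest_weightedIndepNum w).1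
  have hpos := G.weightedIndepNum_pos hw
  gcongr
  · exact sum_nonneg fun v _ => hw.1 v
  · exact hYw.trans_le (hb Y hY)

theorem fractionalChromaticNumber_nonneg [Fintype V] (G : SimpleGraph V) :
    0 ≤ G.fractionalChromaticNumber := by
  refine Real.sSup_nonneg ?_
  rintro _ ⟨w, hw, rfl⟩
  have : Nonempty V := ⟨hw.2.choose⟩
  exact div_nonneg (sum_nonneg fun v _ => hw.1 v) (G.weightedIndepNum_pos hw).le

theorem fractionalChromaticNumber_le_of_hom [Fintype V] [Fintype W] (f : G →g H) :
    G.fractionalChromaticNumber ≤ H.fractionalChromaticNumber := by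
  classical
  refine Real.sSup_le ?_ (fractionalChromaticNumber_nonneg H)
  rintro _ ⟨w, ⟨hw0, v, hv⟩, rfl⟩
  let w' : W → ℝ := fun y => ∑ v with f v = y, w v
  have sum_w' (Y : Finset W) : ∑ y ∈ Y, w' y = ∑ v with f v ∈ Y, w v :=
    sum_fiberwise_eq_sum_filter univ Y f w
  have hw' : IsWeightAssignment w' := by
    refine ⟨fun y => sum_nonneg fun v _ => hw0 v, f v, (ne_of_gt ?_)⟩
    exact sum_pos' (fun v _ => hw0 v) ⟨v, by simp, (hw0 v).lt_of_ne' hv⟩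
  have htotal : ∑ v, w v = ∑ y, w' y := by simp [sum_w']
  rw [htotal]
  refine sum_div_le_fractionalChromaticNumber hw' fun Y hY => ?_
  rw [sum_w']
  refine (G.isGreatest_weightedIndepNum w).2 ⟨_, ?_, rfl⟩
  simpa [Set.preimage] using isIndepSet_preimage f hY

theorem hallRatio_nonneg (G : SimpleGraph V) : 0 ≤ G.hallRatio := by
  refine Real.sSup_nonneg ?_
  rintro _ ⟨K, -, rfl⟩
  positivity

theorem exists_isIndepSet_card_le_hallRatio_mul [Finite V] (G : SimpleGraph V) (A : Finset V) :
    ∃ T ⊆ A, G.IsIndepSet T ∧ (#A : ℝ) ≤ G.hallRatio * #T := by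
  rcases A.eq_empty_or_nonempty with rfl | ⟨v, hv⟩
  · exact ⟨∅, Subset.rfl, by simp, by simp⟩
  have : Nonempty V := ⟨v⟩
  let K : G.Subgraph := (⊤ : G.Subgraph).induce A
  obtain ⟨T, hT⟩ := K.coe.exists_isNIndepSet_indepNum
  have hTpos : 0 < #T := by
    have : K.coe.IsIndepSet (({⟨v, hv⟩} : Finset K.verts) : Set K.verts) := by simp
    rw [hT.card_eq]
    exact this.card_le_indepNum
  have hratio : (#A : ℝ) / #T ≤ G.hallRatio :=
    G.isGreatest_hallRatio.2 ⟨K, ⟨v, hv⟩, by simp [K, hT.card_eq]⟩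
  refine ⟨T.map (.subtype _), fun x hx => ?_, ?_, ?_⟩
  · obtain ⟨y, -, rfl⟩ := mem_map.1 hx
    exact y.2
  · intro x hx y hy hxy hadj
    obtain ⟨x, hxT, rfl⟩ := mem_map.1 hx
    obtain ⟨y, hyT, rfl⟩ := mem_map.1 hy
    exact hT.isIndepSet hxT hyT (ne_of_apply_ne _ hxy) ⟨x.2, y.2, hadj⟩
  · rw [card_map]
    exact (div_le_iff₀ (Nat.cast_pos.2 hTpos)).1 hratio

theorem hallRatio_le [Finite V] {r : ℝ} (hr : 0 ≤ r)
    (h : ∀ A : Finset V, A.Nonempty → ∃ T ⊆ A, G.IsIndepSet T ∧ (#A : ℝ) ≤ r * #T) :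
    G.hallRatio ≤ r := by
  classical
  refine Real.sSup_le ?_ hr
  rintro _ ⟨K, hK, rfl⟩
  obtain ⟨T, hTK, hT, hle⟩ := h K.verts.toFinite.toFinset (by simpa using hK)
  rw [← Set.ncard_eq_toFinset_card] at hle
  have hindep : K.coe.IsIndepSet (T.subtype (· ∈ K.verts) : Set K.verts) :=
    (isIndepSet_preimage K.hom hT).mono fun _ => mem_subtype.1
  have hcard : #T ≤ K.coe.indepNum := by
    have := hindep.card_le_indepNum
    rwa [card_subtype, filter_true_of_mem fun v hv => by simpa using hTK hv] at this
  refine div_le_of_le_mul₀ (Nat.cast_nonneg _) hr (hle.trans ?_)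
  gcongr

theorem hallRatio_le_of_isContained [Finite V] [Finite W] (h : G.IsContained H) :
    G.hallRatio ≤ H.hallRatio := by
  obtain ⟨f⟩ := h
  refine hallRatio_le (hallRatio_nonneg H) fun A _ => ?_
  obtain ⟨T, hTA, hT, hle⟩ := exists_isIndepSet_card_le_hallRatio_mul H (A.map f.toEmbedding)
  obtain ⟨S, hSA, rfl⟩ := subset_map_iff.1 hTA
  refine ⟨S, hSA, (isIndepSet_preimage f.toHom hT).mono fun v hv => ?_, by simpa using hle⟩
  exact mem_coe.2 (mem_map_of_mem f.toEmbedding hv)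

theorem hallRatio_top [Fintype V] : (⊤ : SimpleGraph V).hallRatio = Fintype.card V := by
  refine le_antisymm (hallRatio_le (Nat.cast_nonneg _) fun A ⟨v, hv⟩ => ?_) ?_
  · exact ⟨{v}, singleton_subset_iff.2 hv, by simp, by simpa using A.card_le_univ⟩
  · obtain ⟨T, -, hT, hle⟩ := exists_isIndepSet_card_le_hallRatio_mul (⊤ : SimpleGraph V) univ
    have hT1 : #T ≤ 1 := card_le_one.2 fun u hu v hv =>
      by_contra fun huv => hT hu hv huv ((top_adj u v).2 huv)
    exact hle.trans (mul_le_of_le_one_right (hallRatio_nonneg _) (by exact_mod_cast hT1))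

theorem hallRatio_sum_le [Finite V] [Finite W] (G : SimpleGraph V) (H : SimpleGraph W) :
    (G ⊕g H).hallRatio ≤ max G.hallRatio H.hallRatio := by
  refine hallRatio_le (le_max_of_le_left (hallRatio_nonneg G)) fun A _ => ?_
  obtain ⟨S, hSA, hS, hAS⟩ := exists_isIndepSet_card_le_hallRatio_mul G A.toLeft
  obtain ⟨T, hTA, hT, hAT⟩ := exists_isIndepSet_card_le_hallRatio_mul H A.toRight
  refine ⟨S.disjSum T, ?_, ?_, ?_⟩
  · rw [← A.toLeft_disjSum_toRight]
    exact disjSum_mono hSA hTA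
  · rintro (u | u) hu (v | v) hv huv hadj
    · exact hS (by simpa using hu) (by simpa using hv) (by simpa using huv) hadj
    · simp at hadj
    · simp at hadj
    · exact hT (by simpa using hu) (by simpa using hv) (by simpa using huv) hadj
  · calc (#A : ℝ) = #A.toLeft + #A.toRight := by exact_mod_cast A.card_toLeft_add_card_toRight.symm
      _ ≤ G.hallRatio * #S + H.hallRatio * #T := add_le_add hAS hAT
      _ ≤ max G.hallRatio H.hallRatio * #S + max G.hallRatio H.hallRatio * #T := by
        gcongr
        exacts [le_max_left _ _, le_max_right _ _]
      _ = max G.hallRatio H.hallRatio * #(S.disjSum T) := by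
        rw [card_disjSum, Nat.cast_add, mul_add]

end Monotonicity

section Sampling

variable {E Z : Type*} [Fintype E] [MeasurableSpace Z] (μ : Measure Z) [IsProbabilityMeasure μ]

theorem pi_real_forall_mem (F : Finset E) (T : Set Z) :
    (Measure.pi fun _ : E => μ).real {ω | ∀ e ∈ F, ω e ∈ T} = μ.real T ^ #F := by
  have := Measure.pi_pi_finset (fun _ : E => μ) (fun _ => T) F
  rw [prod_const] at this
  simpa [measureReal_def, Set.pi] using congrArg ENNReal.toReal this

theorem pi_real_le_card_mem_le (T : Set Z) [DecidablePred (· ∈ T)] (r : ℕ) :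
    (Measure.pi fun _ : E => μ).real {ω | r ≤ #{e | ω e ∈ T}} ≤
      (Fintype.card E).choose r * μ.real T ^ r := by
  have hsub : {ω : E → Z | r ≤ #{e | ω e ∈ T}} ⊆
      ⋃ F ∈ powersetCard r univ, {ω | ∀ e ∈ F, ω e ∈ T} := by
    intro ω hω
    obtain ⟨F, hFT, hFr⟩ := exists_subset_card_eq (show r ≤ #{e | ω e ∈ T} from hω)
    refine Set.mem_biUnion (mem_powersetCard.2 ⟨subset_univ F, hFr⟩) fun e he => ?_
    exact (mem_filter.1 (hFT he)).2
  calc _ ≤ ∑ F ∈ powersetCard r (univ : Finset E),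
        (Measure.pi fun _ : E => μ).real {ω | ∀ e ∈ F, ω e ∈ T} :=
        (measureReal_mono hsub (measure_ne_top _ _)).trans (measureReal_biUnion_finset_le _ _)
    _ = ∑ _F ∈ powersetCard r (univ : Finset E), μ.real T ^ r := by
        refine sum_congr rfl fun _ hF => ?_
        rw [pi_real_forall_mem, (mem_powersetCard.1 hF).2]
    _ = (Fintype.card E).choose r * μ.real T ^ r := by
        rw [sum_const, card_powersetCard, card_univ, nsmul_eq_mul]

theorem pi_real_forall_notMem_le {T : Set Z} (hT : MeasurableSet T) :
    (Measure.pi fun _ : E => μ).real {ω | ∀ e, ω e ∉ T} ≤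
      Real.exp (-(Fintype.card E * μ.real T)) := by
  calc (Measure.pi fun _ : E => μ).real {ω | ∀ e, ω e ∉ T}
      = (1 - μ.real T) ^ Fintype.card E := by
        simpa [probReal_compl_eq_one_sub hT] using pi_real_forall_mem μ (univ : Finset E) Tᶜ
    _ ≤ Real.exp (-μ.real T) ^ Fintype.card E := by
        gcongr
        · exact sub_nonneg.2 measureReal_le_one
        · exact Real.one_sub_le_exp_neg _
    _ = Real.exp (-(Fintype.card E * μ.real T)) := by rw [← Real.exp_nat_mul, mul_neg]

-- The two quotients of a power by a factorial cost `exp 2 ≤ 8` per element, and `8 / 32 = 1 / 4`.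
theorem choose_mul_choose_mul_pow_le {v n m : ℕ} {x : ℝ} (hvn : v ≤ n)
    (hx : 32 * n ^ 3 * x ^ 2 ≤ m ^ 3) :
    (v.choose m : ℝ) * (n.choose (2 * m) * x ^ (2 * m)) ≤ (1 / 4) ^ m := by
  rcases n.eq_zero_or_pos with rfl | hn
  · rcases m.eq_zero_or_pos with rfl | hm
    · simp
    · rw [Nat.choose_eq_zero_of_lt (by omega : 0 < 2 * m)]
      simp
  have hv : (v.choose m : ℝ) ≤ n ^ m / m.factorial :=
    (Nat.choose_le_pow_div m v).trans (by gcongr)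
  have hx' : x ^ 2 ≤ m ^ 3 / (32 * n ^ 3) := by
    rw [le_div_iff₀' (by positivity)]
    exact hx
  have hexp : Real.exp m * Real.exp m ≤ 8 ^ m := by
    have : Real.exp 1 ^ 2 ≤ 8 := by
      nlinarith [Real.exp_one_lt_d9, Real.exp_pos 1]
    calc Real.exp m * Real.exp m = (Real.exp 1 ^ 2) ^ m := by
          rw [← Real.exp_add, ← mul_two, ← pow_mul, ← Real.exp_nat_mul]
          congr 1
          push_cast
          ring
      _ ≤ 8 ^ m := by gcongr
  calc (v.choose m : ℝ) * (n.choose (2 * m) * x ^ (2 * m))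
      ≤ n ^ m / m.factorial *
          (n ^ (2 * m) / (2 * m).factorial * (m ^ 3 / (32 * n ^ 3)) ^ m) := by
        rw [pow_mul x]
        gcongr
        exact Nat.choose_le_pow_div (2 * m) n
    _ = m ^ m / m.factorial * (m ^ (2 * m) / (2 * m).factorial) * (1 / 32) ^ m := by
        rw [div_pow, mul_pow, one_div, inv_pow]
        field_simp
        ring
    _ ≤ Real.exp m * Real.exp m * (1 / 32) ^ m := by
        gcongr
        all_goals exact Real.pow_div_factorial_le_exp _ (Nat.cast_nonneg m) _
    _ ≤ 8 ^ m * (1 / 32) ^ m := by gcongr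
    _ = (1 / 4) ^ m := by rw [← mul_pow]; norm_num

theorem sum_div_choose_card {V : Type*} [Fintype V] (g : ℕ → ℝ) :
    ∑ S : Finset V, g #S / (Fintype.card V).choose #S = ∑ m ∈ range (Fintype.card V + 1), g m := by
  rw [← powerset_univ, sum_powerset_apply_card fun m => g m / (Fintype.card V).choose m, card_univ]
  refine sum_congr rfl fun m hm => ?_
  have : ((Fintype.card V).choose m : ℝ) ≠ 0 := by
    exact_mod_cast (Nat.choose_pos (mem_range_succ_iff.1 hm)).ne'
  rw [nsmul_eq_mul, mul_div_cancel₀ _ this]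

theorem sum_nonempty_pow_card_div_choose_le {V : Type*} [Fintype V] :
    ∑ S : Finset V with S.Nonempty, (1 / 4 : ℝ) ^ #S / (Fintype.card V).choose #S ≤ 1 / 3 := by
  classical
  have hgeom : ∑ m ∈ range (Fintype.card V + 1), (1 / 4 : ℝ) ^ m ≤ 4 / 3 := by
    have hsum : HasSum (fun m => (1 / 4 : ℝ) ^ m) (1 - 1 / 4)⁻¹ :=
      hasSum_geometric_of_lt_one (by norm_num) (by norm_num)
    norm_num only at hsum
    exact sum_le_hasSum _ (fun m _ => by positivity) hsum
  have hfilter : ({S | S.Nonempty} : Finset (Finset V)) = univ.erase ∅ := by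
    ext S
    simp [nonempty_iff_ne_empty]
  rw [hfilter, sum_erase_eq_sub (mem_univ _), sum_div_choose_card fun m => (1 / 4) ^ m]
  simp only [card_empty, pow_zero, Nat.choose_zero_right, Nat.cast_one, div_one]
  linarith

variable {V : Type*} [Fintype V] [MeasurableSpace V]
  (ν : Measure V) [IsProbabilityMeasure ν]

theorem pi_real_exists_heavy_forall_notMem_le [DiscreteMeasurableSpace V] {δ : ℝ} (hδ : 0 ≤ δ)
    (hE : 2 * Fintype.card V + 1 ≤ δ ^ 2 * Fintype.card E) :
    (Measure.pi fun _ : E => ν.prod ν).real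
      {ω | ∃ Y Z : Finset V, δ ≤ ν.real Y ∧ δ ≤ ν.real Z ∧ ∀ e, ω e ∉ Y ×ˢ Z} ≤ 1 / 2 := by
  classical
  set P := Measure.pi fun _ : E => ν.prod ν
  let heavy : Finset (Finset V × Finset V) := {x | δ ≤ ν.real x.1 ∧ δ ≤ ν.real x.2}
  let missed (x : Finset V × Finset V) : Set (E → V × V) :=
    {ω | ∀ e, ω e ∉ (x.1 ×ˢ x.2 : Set (V × V))}
  have hmissed (x) (hx : x ∈ heavy) : P.real (missed x) ≤ Real.exp (-(2 * Fintype.card V + 1)) := by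
    obtain ⟨hY, hZ⟩ := (mem_filter.1 hx).2
    refine (pi_real_forall_notMem_le (ν.prod ν) .of_discrete).trans ?_
    refine Real.exp_le_exp.2 (neg_le_neg ?_)
    rw [measureReal_prod_prod]
    calc (2 * Fintype.card V + 1 : ℝ) ≤ Fintype.card E * (δ * δ) := by linarith
      _ ≤ Fintype.card E * (ν.real x.1 * ν.real x.2) := by gcongr
  have hexp : (4 : ℝ) ^ Fintype.card V ≤ Real.exp (2 * Fintype.card V) := by
    rw [mul_comm, Real.exp_nat_mul]
    gcongr
    have := Real.quadratic_le_exp_of_nonneg (x := 2) (by norm_num)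
    linarith
  calc _ ≤ P.real (⋃ x ∈ heavy, missed x) := by
        refine measureReal_mono ?_ (measure_ne_top _ _)
        rintro ω ⟨Y, Z, hY, hZ, hω⟩
        exact Set.mem_biUnion (x := (Y, Z)) (by simp [heavy, hY, hZ]) fun e => by simpa using hω e
    _ ≤ ∑ x ∈ heavy, P.real (missed x) := measureReal_biUnion_finset_le _ _
    _ ≤ #heavy • Real.exp (-(2 * Fintype.card V + 1)) := sum_le_card_nsmul _ _ _ hmissed
    _ ≤ (4 : ℝ) ^ Fintype.card V * Real.exp (-(2 * Fintype.card V + 1)) := by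
        rw [nsmul_eq_mul]
        gcongr
        exact_mod_cast heavy.card_le_univ.trans_eq (by simp [← mul_pow])
    _ ≤ Real.exp (2 * Fintype.card V) * Real.exp (-(2 * Fintype.card V + 1)) := by gcongr
    _ = (Real.exp 1)⁻¹ := by rw [← Real.exp_add, ← Real.exp_neg]; congr 1; ring
    _ ≤ 1 / 2 := by
        rw [one_div]
        gcongr
        linarith [Real.add_one_le_exp (1 : ℝ)]

theorem pi_real_exists_light_le_card_mem_le [DecidableEq V]
    (hE : Fintype.card V ≤ Fintype.card E) :
    (Measure.pi fun _ : E => ν.prod ν).real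
      {ω | ∃ S : Finset V, S.Nonempty ∧ 32 * Fintype.card E ^ 3 * ν.real S ^ 4 ≤ #S ^ 3 ∧
        2 * #S ≤ #{e | ω e ∈ S ×ˢ S}} ≤ 1 / 3 := by
  classical
  set P := Measure.pi fun _ : E => ν.prod ν
  let light : Finset (Finset V) :=
    {S | S.Nonempty ∧ 32 * Fintype.card E ^ 3 * ν.real S ^ 4 ≤ #S ^ 3}
  let crowded (S : Finset V) : Set (E → V × V) :=
    {ω | 2 * #S ≤ #{e | ω e ∈ (S ×ˢ S : Set (V × V))}}
  have hcrowded (S) (hS : S ∈ light) :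
      P.real (crowded S) ≤ (1 / 4) ^ #S / (Fintype.card V).choose #S := by
    have hchoose : (0 : ℝ) < (Fintype.card V).choose #S :=
      Nat.cast_pos.2 (Nat.choose_pos S.card_le_univ)
    rw [le_div_iff₀' hchoose]
    calc _ ≤ ((Fintype.card V).choose #S : ℝ) *
          ((Fintype.card E).choose (2 * #S) * (ν.real S * ν.real S) ^ (2 * #S)) := by
          gcongr
          rw [← measureReal_prod_prod]
          exact pi_real_le_card_mem_le _ _ _
      _ ≤ (1 / 4) ^ #S := by
          refine choose_mul_choose_mul_pow_le hE ?_
          convert (mem_filter.1 hS).2.2 using 1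
          ring
  calc _ ≤ P.real (⋃ S ∈ light, crowded S) := by
        refine measureReal_mono ?_ (measure_ne_top _ _)
        rintro ω ⟨S, hne, hS, hω⟩
        refine Set.mem_biUnion (x := S) (by simp [light, hne, hS]) ?_
        simpa [crowded] using hω
    _ ≤ ∑ S ∈ light, P.real (crowded S) := measureReal_biUnion_finset_le _ _
    _ ≤ ∑ S ∈ light, (1 / 4 : ℝ) ^ #S / (Fintype.card V).choose #S := sum_le_sum hcrowded
    _ ≤ ∑ S : Finset V with S.Nonempty, (1 / 4 : ℝ) ^ #S / (Fintype.card V).choose #S :=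
        sum_le_sum_of_subset_of_nonneg (monotone_filter_right _ fun S _ hS => hS.1)
          fun _ _ _ => by positivity
    _ ≤ 1 / 3 := sum_nonempty_pow_card_div_choose_le

theorem exists_measure_real_eq_sum [DiscreteMeasurableSpace V] {w : V → ℝ}
    (hw : ∀ v, 0 ≤ w v) (hw1 : ∑ v, w v = 1) :
    ∃ ν : Measure V, IsProbabilityMeasure ν ∧ ∀ S : Finset V, ν.real S = ∑ v ∈ S, w v := by
  let p : PMF V := PMF.ofFintype (fun v => ENNReal.ofReal (w v)) <| by
    rw [← ENNReal.ofReal_sum_of_nonneg fun v _ => hw v, hw1, ENNReal.ofReal_one]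
  refine ⟨p.toMeasure, inferInstance, fun S => ?_⟩
  rw [measureReal_def, PMF.toMeasure_apply_finset, ENNReal.toReal_sum fun v _ => p.apply_ne_top v]
  exact sum_congr rfl fun v _ => ENNReal.toReal_ofReal (hw v)

theorem exists_notMem_notMem_of_real_add_real_lt_one {s t : Set Z}
    (h : μ.real s + μ.real t < 1) : ∃ ω, ω ∉ s ∧ ω ∉ t := by
  by_contra! hst
  have hcover : s ∪ t = Set.univ := Set.eq_univ_of_forall fun ω => or_iff_not_imp_left.2 (hst ω)
  have hunion := measureReal_union_le (μ := μ) s t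
  rw [hcover, probReal_univ] at hunion
  linarith

theorem exists_sample_pairs {V : Type*} [Fintype V] [DecidableEq V] {w : V → ℝ}
    (hw : ∀ v, 0 ≤ w v) (hw1 : ∑ v, w v = 1) {δ : ℝ} (hδ0 : 0 ≤ δ) (hδ1 : δ ≤ 1)
    (hE : 2 * Fintype.card V + 1 ≤ δ ^ 2 * Fintype.card E) :
    ∃ p : E → V × V,
      (∀ Y Z : Finset V, δ ≤ ∑ v ∈ Y, w v → δ ≤ ∑ v ∈ Z, w v → ∃ e, p e ∈ Y ×ˢ Z) ∧
      ∀ S : Finset V, S.Nonempty → 32 * Fintype.card E ^ 3 * (∑ v ∈ S, w v) ^ 4 ≤ #S ^ 3 →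
        #{e | p e ∈ S ×ˢ S} < 2 * #S := by
  let _ : MeasurableSpace V := ⊤
  obtain ⟨ν, _, hν⟩ := exists_measure_real_eq_sum hw hw1
  have hVE : Fintype.card V ≤ Fintype.card E := by
    have : δ ^ 2 * Fintype.card E ≤ Fintype.card E :=
      mul_le_of_le_one_left (Nat.cast_nonneg _) (pow_le_one₀ hδ0 hδ1)
    exact_mod_cast (by linarith : (Fintype.card V : ℝ) ≤ Fintype.card E)
  have hheavy := pi_real_exists_heavy_forall_notMem_le ν hδ0 hE
  have hlight := pi_real_exists_light_le_card_mem_le ν hVE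
  obtain ⟨p, hp_heavy, hp_light⟩ := exists_notMem_notMem_of_real_add_real_lt_one
    (Measure.pi fun _ : E => ν.prod ν) ((add_le_add hheavy hlight).trans_lt (by norm_num))
  simp only [Set.mem_ofPred, hν] at hp_heavy hp_light
  push Not at hp_heavy hp_light
  exact ⟨p, hp_heavy, hp_light⟩

end Sampling

section Sparse

variable {V E : Type*} {G : SimpleGraph V}

theorem exists_isIndepSet_card_le_succ_mul [DecidableRel G.Adj] {d : ℕ} {B : Finset V}
    (hB : ∀ S ⊆ B, S.Nonempty → ∃ v ∈ S, #{u ∈ S | G.Adj v u} ≤ d) :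
    ∃ T ⊆ B, G.IsIndepSet T ∧ #B ≤ (d + 1) * #T := by
  classical
  induction B using Finset.strongInduction with
  | H B ih =>
  rcases B.eq_empty_or_nonempty with rfl | hne
  · exact ⟨∅, Subset.rfl, by simp, by simp⟩
  obtain ⟨v, hv, hdeg⟩ := hB B Subset.rfl hne
  let N : Finset V := insert v {u ∈ B | G.Adj v u}
  have hNB : N ⊆ B := insert_subset hv (filter_subset _ _)
  obtain ⟨T, hTB, hT, hcard⟩ := ih (B \ N) (sdiff_ssubset hNB (insert_nonempty _ _))
    fun S hS => hB S (hS.trans sdiff_subset)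
  have hvT : v ∉ T := fun h => (mem_sdiff.1 (hTB h)).2 (mem_insert_self _ _)
  have hTadj (u) (hu : u ∈ T) : ¬ G.Adj v u := fun huv =>
    have huBN := mem_sdiff.1 (hTB hu)
    huBN.2 (mem_insert_of_mem (mem_filter.2 ⟨huBN.1, huv⟩))
  refine ⟨insert v T, insert_subset hv (hTB.trans sdiff_subset), ?_, ?_⟩
  · rw [coe_insert]
    exact Set.Pairwise.insert hT fun u hu _ => ⟨hTadj u hu, fun h => hTadj u hu h.symm⟩
  · have hN : #N ≤ d + 1 := (card_insert_le _ _).trans (Nat.succ_le_succ hdeg)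
    rw [card_insert_of_notMem hvT, mul_add_one, ← card_sdiff_add_card_eq_card hNB]
    exact add_le_add hcard hN

variable [Fintype E] [DecidableEq V] {p : E → V × V}
  (hG : ∀ ⦃u v⦄, G.Adj u v → ∃ e, p e = (u, v) ∨ p e = (v, u))
include hG

theorem sum_card_adj_le_two_mul [DecidableRel G.Adj] (S : Finset V) :
    ∑ v ∈ S, #{u ∈ S | G.Adj v u} ≤ 2 * #{e | p e ∈ S ×ˢ S} := by
  set I : Finset E := {e | p e ∈ S ×ˢ S}
  have hI (e) (he : e ∈ I) : (p e).1 ∈ S ∧ (p e).2 ∈ S := mem_product.1 (mem_filter.1 he).2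
  have hdeg (v) (hv : v ∈ S) :
      #{u ∈ S | G.Adj v u} ≤ #{e ∈ I | (p e).1 = v} + #{e ∈ I | (p e).2 = v} := by
    have hsub : ({u ∈ S | G.Adj v u} : Finset V) ⊆
        ({e ∈ I | (p e).1 = v} : Finset E).image (fun e => (p e).2) ∪
          ({e ∈ I | (p e).2 = v} : Finset E).image (fun e => (p e).1) := by
      intro u hu
      obtain ⟨huS, huv⟩ := mem_filter.1 hu
      obtain ⟨e, he | he⟩ := hG huv
      · exact mem_union_left _ (mem_image.2 ⟨e, by simp [I, he, huS, hv], by rw [he]⟩)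
      · exact mem_union_right _ (mem_image.2 ⟨e, by simp [I, he, huS, hv], by rw [he]⟩)
    exact (card_le_card hsub).trans <| (card_union_le _ _).trans <|
      add_le_add card_image_le card_image_le
  calc ∑ v ∈ S, #{u ∈ S | G.Adj v u}
      ≤ ∑ v ∈ S, #{e ∈ I | (p e).1 = v} + ∑ v ∈ S, #{e ∈ I | (p e).2 = v} :=
        (sum_le_sum hdeg).trans_eq sum_add_distrib
    _ = 2 * #I := by
        rw [← card_eq_sum_card_fiberwise fun e he => (hI e he).1,
          ← card_eq_sum_card_fiberwise fun e he => (hI e he).2, two_mul]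

theorem exists_isIndepSet_card_le_four_mul {B : Finset V}
    (hB : ∀ S ⊆ B, S.Nonempty → #{e | p e ∈ S ×ˢ S} < 2 * #S) :
    ∃ T ⊆ B, G.IsIndepSet T ∧ #B ≤ 4 * #T := by
  classical
  refine exists_isIndepSet_card_le_succ_mul fun S hS hne => ?_
  by_contra! hdeg
  have := card_nsmul_le_sum S _ 4 hdeg
  have := sum_card_adj_le_two_mul hG S
  have := hB S hS hne
  rw [smul_eq_mul] at *
  omega

end Sparse

section Layers

variable {V E ι : Type*}

/-- The graph on `V` whose edges are the pairs `p e` joining two different layers. -/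
def layeredGraph (layer : V → ι) (p : E → V × V) : SimpleGraph V :=
  fromRel (fun u v => ∃ e, p e = (u, v)) ⊓ (⊤ : SimpleGraph ι).comap layer

variable {layer : V → ι} {p : E → V × V}

theorem layeredGraph_adj {u v : V} :
    (layeredGraph layer p).Adj u v ↔
      layer u ≠ layer v ∧ ∃ e, p e = (u, v) ∨ p e = (v, u) := by
  simp only [layeredGraph, inf_adj, fromRel_adj, comap_adj, top_adj, exists_or]
  exact ⟨fun h => ⟨h.2, h.1.2⟩, fun h => ⟨⟨ne_of_apply_ne layer h.1, h.2⟩, h.1⟩⟩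

theorem isIndepSet_layeredGraph {Y : Set V} {i : ι} (hY : ∀ v ∈ Y, layer v = i) :
    (layeredGraph layer p).IsIndepSet Y :=
  fun u hu v hv _ hadj => (layeredGraph_adj.1 hadj).1 ((hY u hu).trans (hY v hv).symm)

theorem sum_le_add_card_mul [Fintype ι] {f : ι → ℝ} {b c : ℝ} (hb : 0 ≤ b) (hc : 0 ≤ c)
    (hf : ∀ i, f i ≤ b) (hfc : ∀ i j, i ≠ j → f i ≤ c ∨ f j ≤ c) :
    ∑ i, f i ≤ b + Fintype.card ι * c := by
  classical
  by_cases h : ∀ i, f i ≤ c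
  · calc ∑ i, f i ≤ Fintype.card ι * c := by
          simpa using sum_le_card_nsmul univ f c fun i _ => h i
      _ ≤ b + Fintype.card ι * c := le_add_of_nonneg_left hb
  push Not at h
  obtain ⟨i, hi⟩ := h
  have hrest : ∑ j ∈ univ.erase i, f j ≤ #(univ.erase i) • c := sum_le_card_nsmul _ _ _ fun j hj =>
    (hfc i j (ne_of_mem_erase hj).symm).resolve_left hi.not_ge
  calc ∑ i, f i = f i + ∑ j ∈ univ.erase i, f j := (add_sum_erase _ _ (mem_univ i)).symm
    _ ≤ b + #(univ.erase i) • c := add_le_add (hf i) hrest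
    _ ≤ b + Fintype.card ι * c := by
        rw [nsmul_eq_mul]
        gcongr
        exact card_le_univ _

variable [Fintype ι] [DecidableEq ι] {w : V → ℝ}

theorem sum_le_of_isIndepSet_layeredGraph [Fintype V] (hw : ∀ v, 0 ≤ w v) {b δ : ℝ}
    (hb : 0 ≤ b) (hδ : 0 ≤ δ)
    (hlayer : ∀ i, ∑ v with layer v = i, w v ≤ b)
    (hp : ∀ Y Z : Finset V, δ ≤ ∑ v ∈ Y, w v → δ ≤ ∑ v ∈ Z, w v → ∃ e, p e ∈ Y ×ˢ Z)
    {Y : Finset V} (hY : (layeredGraph layer p).IsIndepSet Y) :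
    ∑ v ∈ Y, w v ≤ b + Fintype.card ι * δ := by
  rw [← sum_fiberwise Y layer]
  refine sum_le_add_card_mul hb hδ (fun i => ?_) fun i j hij => ?_
  · exact (sum_le_sum_of_subset_of_nonneg (filter_subset_filter _ (subset_univ Y))
      fun v _ _ => hw v).trans (hlayer i)
  · by_contra! h
    obtain ⟨e, he⟩ := hp _ _ h.1.le h.2.le
    obtain ⟨⟨huY, rfl⟩, hvY, rfl⟩ := (mem_product.1 he).imp mem_filter.1 mem_filter.1
    exact hY huY hvY (ne_of_apply_ne layer hij) (layeredGraph_adj.2 ⟨hij, e, .inl rfl⟩)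

theorem mul_card_le_of_forall_mul_card_fiber_le {R : Finset V} {a c : ℕ}
    (hR : ∀ u ∈ R, c * Fintype.card ι * #{v ∈ R | layer v = layer u} ≤ a) : c * #R ≤ a := by
  rcases R.eq_empty_or_nonempty with rfl | ⟨u, -⟩
  · simp
  have hι : 0 < Fintype.card ι := Fintype.card_pos_iff.2 ⟨layer u⟩
  have hfiber (i : ι) : c * Fintype.card ι * #{v ∈ R | layer v = i} ≤ a := by
    rcases ({v ∈ R | layer v = i} : Finset V).eq_empty_or_nonempty with h | ⟨u, hu⟩
    · simp [h]
    · obtain ⟨huR, rfl⟩ := mem_filter.1 hu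
      exact hR u huR
  refine Nat.le_of_mul_le_mul_left ?_ hι
  calc Fintype.card ι * (c * #R) = ∑ i, c * Fintype.card ι * #{v ∈ R | layer v = i} := by
        rw [← mul_sum, ← card_eq_sum_card_fiberwise fun _ _ => mem_coe.2 (mem_univ _)]
        ring
    _ ≤ Fintype.card ι * a := by
        simpa using sum_le_card_nsmul univ _ a fun i _ => hfiber i

theorem exists_two_mul_card_layer_ne_le [Fintype V] [LinearOrder ι] {A H : Finset V} {c : ℝ}
    (hc : 0 ≤ c) (hne : H.Nonempty) (hH : ∀ v ∈ H, 1 < c * (#A * w v ^ 4))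
    (hsep : ∀ u v, layer u < layer v →
      c * ((2 * Fintype.card ι * #{x | layer x = layer v} : ℕ) * w u ^ 4) ≤ 1) :
    ∃ i, 2 * #{v ∈ H | layer v ≠ i} ≤ #A := by
  obtain ⟨u, hu, hmin⟩ := exists_min_image H layer hne
  refine ⟨layer u, mul_card_le_of_forall_mul_card_fiber_le (layer := layer) fun v hv => ?_⟩
  obtain ⟨hvH, hvu⟩ := mem_filter.1 hv
  have hsmall : 2 * Fintype.card ι * #{x | layer x = layer v} ≤ #A := by
    by_contra! hlarge
    refine (hH u hu).not_ge (le_trans ?_ (hsep u v ((hmin v hvH).lt_of_ne' hvu)))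
    gcongr
  refine le_trans ?_ hsmall
  gcongr
  exact subset_univ _

end Layers

section Hall

variable {V E ι : Type*} {w : V → ℝ}

theorem mul_sum_pow_four_le {S : Finset V} {c : ℝ} (hc : 0 ≤ c) (hw : ∀ v, 0 ≤ w v)
    (hS : ∀ v ∈ S, c * (#S * w v ^ 4) ≤ 1) : c * (∑ v ∈ S, w v) ^ 4 ≤ #S ^ 3 := by
  rcases S.eq_empty_or_nonempty with rfl | hne
  · simp
  have : (0 : ℝ) < #S := Nat.cast_pos.2 hne.card_pos
  have hmean : (∑ v ∈ S, w v) ^ 4 ≤ (∑ v ∈ S, w v ^ 4) * #S ^ 3 :=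
    (div_le_iff₀ (by positivity)).1 (pow_sum_div_card_le_sum_pow (fun v _ => hw v) 3)
  calc c * (∑ v ∈ S, w v) ^ 4 ≤ c * ((∑ v ∈ S, w v ^ 4) * #S ^ 3) := by gcongr
    _ = (∑ v ∈ S, c * (#S * w v ^ 4)) * #S ^ 2 := by
        simp only [← mul_sum]
        ring
    _ ≤ #S * #S ^ 2 := by
        gcongr
        simpa using sum_le_card_nsmul S _ 1 hS
    _ = #S ^ 3 := by ring

theorem exists_isIndepSet_card_le_ten_mul [Fintype V] [DecidableEq V] [Fintype E] [Fintype ι]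
    [LinearOrder ι] {layer : V → ι} {p : E → V × V}
    (hw : ∀ v, 0 ≤ w v)
    (hp : ∀ S : Finset V, S.Nonempty → 32 * Fintype.card E ^ 3 * (∑ v ∈ S, w v) ^ 4 ≤ #S ^ 3 →
      #{e | p e ∈ S ×ˢ S} < 2 * #S)
    (hsep : ∀ u v, layer u < layer v → 32 * (Fintype.card E : ℝ) ^ 3 *
      ((2 * Fintype.card ι * #{x | layer x = layer v} : ℕ) * w u ^ 4) ≤ 1) (A : Finset V) :
    ∃ T ⊆ A, (layeredGraph layer p).IsIndepSet T ∧ #A ≤ 10 * #T := by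
  set c : ℝ := 32 * Fintype.card E ^ 3
  have hc : 0 ≤ c := by positivity
  let light : Finset V := {v ∈ A | c * (#A * w v ^ 4) ≤ 1}
  let heavy : Finset V := {v ∈ A | ¬ c * (#A * w v ^ 4) ≤ 1}
  have hA : #light + #heavy = #A := card_filter_add_card_filter_not _
  obtain ⟨T, hTlight, hT, hlight⟩ : ∃ T ⊆ light, (layeredGraph layer p).IsIndepSet T ∧
      #light ≤ 4 * #T := by
    refine exists_isIndepSet_card_le_four_mul (fun _ _ h => (layeredGraph_adj.1 h).2)
      fun S hS hne => hp S hne (mul_sum_pow_four_le hc hw fun v hv => ?_)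
    refine le_trans ?_ (mem_filter.1 (hS hv)).2
    gcongr
    exact hS.trans (filter_subset _ _)
  have hTA : T ⊆ A := hTlight.trans (filter_subset _ _)
  rcases heavy.eq_empty_or_nonempty with hempty | hne
  · refine ⟨T, hTA, hT, ?_⟩
    rw [hempty, card_empty] at hA
    omega
  obtain ⟨i, hi⟩ := exists_two_mul_card_layer_ne_le hc hne
    (fun v hv => not_le.1 (mem_filter.1 hv).2) hsep
  let C : Finset V := {v ∈ heavy | layer v = i}
  have hC : (layeredGraph layer p).IsIndepSet C :=
    isIndepSet_layeredGraph fun v hv => (mem_filter.1 hv).2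
  have hheavy : #C + #{v ∈ heavy | layer v ≠ i} = #heavy := card_filter_add_card_filter_not _
  rcases le_total #T #C with h | h
  · exact ⟨C, (filter_subset _ _).trans (filter_subset _ _), hC, by omega⟩
  · exact ⟨T, hTA, hT, by omega⟩

end Hall

section Construction

/-- The size of layer `i` out of `k`. It is `a ^ 5 ^ k / a ^ 5 ^ i`, so that the denominators grow
faster than fourth powers. -/
def layerSize (a k : ℕ) (i : Fin k) : ℕ :=
  a ^ (5 ^ k - 5 ^ (i : ℕ))

section LayerSize

variable {a k : ℕ} (ha : 0 < a)
include ha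

theorem layerSize_pos (i : Fin k) : 0 < layerSize a k i :=
  Nat.pow_pos ha

theorem mul_pow_mul_layerSize_le {i j : Fin k} (hij : i < j) :
    a * (a ^ 5 ^ k) ^ 3 * layerSize a k j ≤ layerSize a k i ^ 4 := by
  have hi : 1 ≤ 5 ^ (i : ℕ) := Nat.one_le_pow _ _ (by norm_num)
  have hj : 5 ^ (j : ℕ) ≤ 5 ^ k := Nat.pow_le_pow_right (by norm_num) j.2.le
  have hij5 : 5 * 5 ^ (i : ℕ) ≤ 5 ^ (j : ℕ) := by
    rw [← pow_succ']
    exact Nat.pow_le_pow_right (by norm_num) hij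
  calc a * (a ^ 5 ^ k) ^ 3 * a ^ (5 ^ k - 5 ^ (j : ℕ))
      = a ^ (1 + 5 ^ k * 3 + (5 ^ k - 5 ^ (j : ℕ))) := by rw [pow_add, pow_add, pow_one, pow_mul]
    _ ≤ a ^ ((5 ^ k - 5 ^ (i : ℕ)) * 4) := Nat.pow_le_pow_right ha (by omega)
    _ = (a ^ (5 ^ k - 5 ^ (i : ℕ))) ^ 4 := pow_mul _ _ _

theorem mul_sum_layerSize_le : a * ∑ i, layerSize a k i ≤ k * a ^ 5 ^ k := by
  rw [mul_sum]
  refine (sum_le_card_nsmul univ _ (a ^ 5 ^ k) fun i _ => ?_).trans (by simp)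
  have hi : 1 ≤ 5 ^ (i : ℕ) := Nat.one_le_pow _ _ (by norm_num)
  have hik : 5 ^ (i : ℕ) ≤ 5 ^ k := Nat.pow_le_pow_right (by norm_num) i.2.le
  rw [layerSize, ← pow_succ']
  exact Nat.pow_le_pow_right ha (by omega)

end LayerSize

theorem exists_layer_sizes {k : ℕ} (hk : 0 < k) :
    ∃ (m : Fin k → ℕ) (n : ℕ), (∀ i, 0 < m i) ∧
      (∀ i j, i < j → 64 * k * n ^ 3 * m j ≤ m i ^ 4) ∧ k ^ 4 * (2 * ∑ i, m i + 1) ≤ n := by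
  set a := 64 * k ^ 5
  have ha0 : 0 < a := by positivity
  have hka : 64 * k ≤ a := Nat.mul_le_mul_left 64 (Nat.le_self_pow (by norm_num) k)
  refine ⟨layerSize a k, a ^ 5 ^ k, layerSize_pos ha0, fun i j hij => ?_, ?_⟩
  · refine le_trans ?_ (mul_pow_mul_layerSize_le ha0 hij)
    gcongr
  · have hsum : 1 ≤ ∑ i, layerSize a k i :=
      (layerSize_pos ha0 ⟨0, hk⟩).trans_le (single_le_sum (fun _ _ => Nat.zero_le _) (mem_univ _))
    refine Nat.le_of_mul_le_mul_left ?_ ha0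
    calc a * (k ^ 4 * (2 * ∑ i, layerSize a k i + 1))
        ≤ a * (k ^ 4 * (3 * ∑ i, layerSize a k i)) := by
          gcongr
          omega
      _ = 3 * k ^ 4 * (a * ∑ i, layerSize a k i) := by ring
      _ ≤ 3 * k ^ 4 * (k * a ^ 5 ^ k) := Nat.mul_le_mul_left _ (mul_sum_layerSize_le ha0)
      _ = 3 * k ^ 5 * a ^ 5 ^ k := by ring
      _ ≤ a * a ^ 5 ^ k := Nat.mul_le_mul_right _ (by omega)

theorem card_sigma_fst_eq {ι : Type*} [Fintype ι] [DecidableEq ι] (m : ι → ℕ) (i : ι) :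
    #{v : Σ i, Fin (m i) | v.1 = i} = m i := by
  rw [card_filter, Fintype.sum_sigma]
  simp [apply_ite card]

/-- The probability of `v` when first a layer and then a vertex of that layer is chosen uniformly;
layer `i` has `m i` vertices. -/
noncomputable def layerWeight {k : ℕ} (m : Fin k → ℕ) (v : Σ i, Fin (m i)) : ℝ :=
  1 / (k * m v.1)

section LayerWeight

variable {k : ℕ} {m : Fin k → ℕ}

theorem layerWeight_pos (v : Σ i, Fin (m i)) : 0 < layerWeight m v := by
  have hk : 0 < k := v.1.pos
  have hm : 0 < m v.1 := v.2.pos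
  exact one_div_pos.2 (by positivity)

theorem sum_layerWeight_fst_eq {i : Fin k} (hm : 0 < m i) :
    ∑ v with v.1 = i, layerWeight m v = 1 / k := by
  have hconst (v) (hv : v ∈ ({v | v.1 = i} : Finset (Σ i, Fin (m i)))) :
      layerWeight m v = 1 / (k * m i) := by
    rw [layerWeight, (mem_filter.1 hv).2]
  rw [sum_eq_card_nsmul hconst, card_sigma_fst_eq, nsmul_eq_mul]
  field_simp

theorem sum_layerWeight (hk : 0 < k) (hm : ∀ i, 0 < m i) : ∑ v, layerWeight m v = 1 := by
  rw [← sum_fiberwise univ Sigma.fst, sum_congr rfl fun i _ => sum_layerWeight_fst_eq (hm i)]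
  simp [hk.ne']

theorem mul_layerWeight_pow_four_le {n b : ℕ} {v : Σ i, Fin (m i)}
    (h : 64 * k * n ^ 3 * b ≤ m v.1 ^ 4) :
    32 * (n : ℝ) ^ 3 * ((2 * k * b : ℕ) * layerWeight m v ^ 4) ≤ 1 := by
  have hk : 0 < k := v.1.pos
  have hm : 0 < m v.1 := v.2.pos
  have hle : 64 * k * n ^ 3 * b ≤ (k * m v.1) ^ 4 :=
    h.trans (Nat.pow_le_pow_left (Nat.le_mul_of_pos_left _ hk) 4)
  rw [layerWeight, div_pow, one_pow, mul_one_div, mul_div_assoc', div_le_one₀ (by positivity)]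
  calc 32 * (n : ℝ) ^ 3 * (2 * k * b : ℕ) = (64 * k * n ^ 3 * b : ℕ) := by
        push_cast
        ring
    _ ≤ (k * m v.1 : ℝ) ^ 4 := by exact_mod_cast hle

end LayerWeight

theorem exists_half_le_fractionalChromaticNumber_hallRatio_le {k : ℕ} (hk : 0 < k) :
    ∃ (V : Type) (_ : Fintype V) (G : SimpleGraph V),
      (k / 2 : ℝ) ≤ G.fractionalChromaticNumber ∧ G.hallRatio ≤ 10 := by
  obtain ⟨m, n, hm, hsep, hn⟩ := exists_layer_sizes hk
  let V := Σ i, Fin (m i)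
  have hw (v : V) : 0 ≤ layerWeight m v := (layerWeight_pos v).le
  have hpairs : 2 * Fintype.card V + 1 ≤ (1 / k ^ 2 : ℝ) ^ 2 * Fintype.card (Fin n) := by
    have : (k : ℝ) ^ 4 * (2 * ∑ i, m i + 1) ≤ n := by exact_mod_cast hn
    rw [div_pow, one_pow, ← pow_mul, one_div_mul_eq_div, le_div_iff₀' (by positivity)]
    simpa [V] using this
  have hδ : (1 / k ^ 2 : ℝ) ≤ 1 :=
    div_le_one_of_le₀ (one_le_pow₀ (Nat.one_le_cast.2 hk)) (by positivity)
  obtain ⟨p, hp_heavy, hp_light⟩ :=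
    exists_sample_pairs hw (sum_layerWeight hk hm) (by positivity) hδ hpairs
  refine ⟨V, inferInstance, layeredGraph Sigma.fst p, ?_, ?_⟩
  · have hweight : IsWeightAssignment (layerWeight m) :=
      ⟨hw, ⟨⟨0, hk⟩, ⟨0, hm _⟩⟩, (layerWeight_pos _).ne'⟩
    have hindep (Y : Finset V) (hY : (layeredGraph Sigma.fst p).IsIndepSet Y) :
        ∑ v ∈ Y, layerWeight m v ≤ 2 / k := by
      convert sum_le_of_isIndepSet_layeredGraph hw (by positivity) (by positivity)
        (fun i => (sum_layerWeight_fst_eq (hm i)).le) hp_heavy hY using 1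
      rw [Fintype.card_fin]
      field_simp
      norm_num
    simpa [sum_layerWeight hk hm] using sum_div_le_fractionalChromaticNumber hweight hindep
  · refine hallRatio_le (by norm_num) fun A _ => ?_
    have hsep' (u v : V) (huv : u.1 < v.1) : 32 * (Fintype.card (Fin n) : ℝ) ^ 3 *
        ((2 * Fintype.card (Fin k) * #{x : V | x.1 = v.1} : ℕ) * layerWeight m u ^ 4) ≤ 1 := by
      rw [card_sigma_fst_eq, Fintype.card_fin, Fintype.card_fin]
      exact mul_layerWeight_pow_four_le (hsep _ _ huv)
    exact_mod_cast exists_isIndepSet_card_le_ten_mul hw hp_light hsep' A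

end Construction

end HallRatio

theorem corollary3_general {r : ℕ} (hr : 10 ≤ r) (c : ℝ) :
    ∃ (n : ℕ) (G : SimpleGraph (Fin n)),
      0 < n ∧ c ≤ G.fractionalChromaticNumber ∧ G.hallRatio = r := by
  obtain ⟨k, hk⟩ := exists_nat_gt (max (2 * c) 0)
  obtain ⟨V, _, G, hχ, hρ⟩ :=
    HallRatio.exists_half_le_fractionalChromaticNumber_hallRatio_le
      (Nat.cast_pos.1 ((le_max_right _ _).trans_lt hk))
  let K := (⊤ : SimpleGraph (Fin r)) ⊕g G
  let e : K ≃g K.overFin rfl := K.overFinIso rfl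
  have hn : 0 < Fintype.card (Fin r ⊕ V) := by
    rw [Fintype.card_sum, Fintype.card_fin]
    omega
  refine ⟨_, K.overFin rfl, hn, ?_, le_antisymm ?_ ?_⟩
  · calc c ≤ k / 2 := by linarith [(le_max_left (2 * c) 0).trans_lt hk]
      _ ≤ G.fractionalChromaticNumber := hχ
      _ ≤ (K.overFin rfl).fractionalChromaticNumber :=
        HallRatio.fractionalChromaticNumber_le_of_hom (e.toHom.comp Embedding.sumInr.toHom)
  · calc (K.overFin rfl).hallRatio ≤ K.hallRatio :=
        HallRatio.hallRatio_le_of_isContained ⟨e.symm.toCopy⟩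
      _ ≤ max (⊤ : SimpleGraph (Fin r)).hallRatio G.hallRatio := HallRatio.hallRatio_sum_le _ _
      _ ≤ r := by
        rw [HallRatio.hallRatio_top, Fintype.card_fin]
        exact max_le le_rfl (hρ.trans (by exact_mod_cast hr))
  · calc (r : ℝ) = (⊤ : SimpleGraph (Fin r)).hallRatio := by
          rw [HallRatio.hallRatio_top, Fintype.card_fin]
      _ ≤ (K.overFin rfl).hallRatio :=
        HallRatio.hallRatio_le_of_isContained ⟨e.toCopy.comp Embedding.sumInl.toCopy⟩

theorem corollary3 :
    (∀ c : ℕ, 0 < c → ∃ (n : ℕ) (G : SimpleGraph (Fin n)),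
      (c : ℝ) ≤ G.fractionalChromaticNumber ∧ G.hallRatio ≤ 18) ∧
    ¬ ∃ f : ℝ → ℝ, ∀ (n : ℕ) (G : SimpleGraph (Fin n)), 0 < n →
      G.fractionalChromaticNumber ≤ f G.hallRatio := by
  refine ⟨fun c _ => ?_, fun ⟨f, hf⟩ => ?_⟩
  · obtain ⟨n, G, -, hχ, hρ⟩ := corollary3_general (r := 18) (by norm_num) c
    exact ⟨n, G, hχ, hρ.le⟩
  · obtain ⟨n, G, hn, hχ, hρ⟩ := corollary3_general (r := 18) (by norm_num) (f (18 : ℕ) + 1)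
    exact (lt_add_one _).not_ge (hχ.trans (hρ ▸ hf n G hn))
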